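/- Let $K$ be Alexandrov's "two arrows" space, that is, the set $$K=\{(x,0):0<x\le 1\}\cup\{(x,1):0\le x<1\}$$ with the order topology of the lexicographic order, which is a compact Hausdorff space. Let $\mathbb K=\mathbb R$ or $\mathbb K=\mathbb C$, and let $C(K)$ be the Banach space of continuous functions $K\to\mathbb K$ with the supremum norm. The map $g\mapsto g\circ\pi$, where $\pi:K\to[0,1]$, $\pi(x,i)=x$, is an isometric embedding of $C[0,1]$ into $C(K)$; regard $C[0,1]$ as a subspace of $C(K)$ through it. (A subspace $Y$ of a Banach space $X$ is called complemented if there is a continuous linear projection from $X$ onto $Y$.) Then $C[0,1]$ is not complemented in $C(K)$. Moreover, $C[0,1]$ is not contained in any separable complemented subspace of $C(K)$. -/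

import Mathlib

/-- The underlying set of Alexandrov's "two arrows" space: the points `(x, 0)` with `0 < x ≤ 1`
and the points `(x, 1)` with `0 ≤ x < 1` of `[0,1] × {0,1}` (with `Bool` for `{0,1}`). -/
def TwoArrows : Type :=
  {p : unitInterval ×ₗ Bool // p ≠ toLex (0, false) ∧ p ≠ toLex (1, true)}

namespace TwoArrows

/-- The lexicographic order. -/
noncomputable instance : LinearOrder TwoArrows :=
  inferInstanceAs (LinearOrder
    {p : unitInterval ×ₗ Bool // p ≠ toLex (0, false) ∧ p ≠ toLex (1, true)})

/-- The topology of the two arrows space is the order topology of the lexicographic order. -/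
noncomputable instance : TopologicalSpace TwoArrows := Preorder.topology TwoArrows

instance : OrderTopology TwoArrows := ⟨rfl⟩

/-- The first coordinate of a point. -/
def fst (p : TwoArrows) : unitInterval := (ofLex p.1).1

/-- The second coordinate of a point: `false` for the lower arrow, `true` for the upper one. -/
def snd (p : TwoArrows) : Bool := (ofLex p.1).2

theorem lt_iff {p q : TwoArrows} :
    p < q ↔ p.fst < q.fst ∨ p.fst = q.fst ∧ p.snd < q.snd :=
  Prod.Lex.lt_iff

theorem le_iff {p q : TwoArrows} :
    p ≤ q ↔ p.fst < q.fst ∨ p.fst = q.fst ∧ p.snd ≤ q.snd :=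
  Prod.Lex.le_iff

/-- The point `(x, 0)`, for `0 < x`. -/
def lower (x : unitInterval) (hx : 0 < x) : TwoArrows :=
  ⟨toLex (x, false), fun h => hx.ne' (congrArg (fun p => (ofLex p).1) h),
    fun h => Bool.false_ne_true (congrArg (fun p => (ofLex p).2) h)⟩

/-- The point `(x, 1)`, for `x < 1`. -/
def upper (x : unitInterval) (hx : x < 1) : TwoArrows :=
  ⟨toLex (x, true), fun h => Bool.false_ne_true (congrArg (fun p => (ofLex p).2) h).symm,
    fun h => hx.ne (congrArg (fun p => (ofLex p).1) h)⟩

theorem fst_pos_of_snd {p : TwoArrows} (h : p.snd = false) : 0 < p.fst := by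
  refine lt_of_le_of_ne unitInterval.nonneg' fun h0 => p.2.1 ?_
  exact congrArg toLex (Prod.ext h0.symm h)

theorem fst_lt_one_of_snd {p : TwoArrows} (h : p.snd = true) : p.fst < 1 := by
  refine lt_of_le_of_ne unitInterval.le_one' fun h0 => p.2.2 ?_
  exact congrArg toLex (Prod.ext h0 h)

theorem fst_surjective : Function.Surjective fst := by
  intro x
  by_cases hx : x < 1
  · exact ⟨upper x hx, rfl⟩
  · have h1 : x = 1 := le_antisymm unitInterval.le_one' (not_lt.1 hx)
    exact ⟨lower x (h1 ▸ zero_lt_one), rfl⟩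

theorem fst_monotone : Monotone fst := by
  intro p q h
  rcases le_iff.1 h with h | h
  · exact h.le
  · exact h.1.le

theorem continuous_fst : Continuous fst :=
  fst_monotone.continuous_of_surjective fst_surjective

theorem exists_isLUB (s : Set TwoArrows) : ∃ p, IsLUB s p := by
  rcases s.eq_empty_or_nonempty with rfl | ⟨q, hq⟩
  · refine ⟨upper 0 zero_lt_one, by simp, fun r _ => ?_⟩
    rw [le_iff]
    rcases (unitInterval.nonneg' (t := r.fst)).lt_or_eq with h | h
    · exact Or.inl h
    · refine Or.inr ⟨h, ?_⟩
      by_contra hc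
      have : r.snd = false := by
        cases hr : r.snd
        · rfl
        · exact (hc (by rw [hr]; exact le_rfl)).elim
      exact (fst_pos_of_snd this).ne h
  · obtain ⟨x, hx⟩ : ∃ x, IsLUB (fst '' s) x := ⟨_, isLUB_sSup _⟩
    by_cases h : ∃ p ∈ s, p.fst = x ∧ p.snd = true
    · obtain ⟨p, hp, hpx, hp1⟩ := h
      refine ⟨p, fun r hr => ?_, fun u hu => hu hp⟩
      rw [le_iff]
      rcases (hx.1 ⟨r, hr, rfl⟩ : r.fst ≤ x).lt_or_eq with h | h
      · exact Or.inl (hpx ▸ h)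
      · exact Or.inr ⟨h.trans hpx.symm, hp1 ▸ Bool.le_true _⟩
    · push Not at h
      rcases (unitInterval.nonneg' (t := x)).lt_or_eq with h0 | h0
      · refine ⟨lower x h0, fun r hr => ?_, fun u hu => ?_⟩
        · rw [le_iff]
          rcases (hx.1 ⟨r, hr, rfl⟩ : r.fst ≤ x).lt_or_eq with h1 | h1
          · exact Or.inl h1
          · refine Or.inr ⟨h1, ?_⟩
            have : r.snd = false := by simpa using h r hr h1
            rw [this]; exact Bool.false_le _
        · rw [le_iff]
          have : x ≤ u.fst := hx.2 (by rintro _ ⟨r, hr, rfl⟩; exact fst_monotone (hu hr))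
          rcases this.lt_or_eq with h1 | h1
          · exact Or.inl h1
          · exact Or.inr ⟨h1, Bool.false_le _⟩
      · exfalso
        have hq0 : q.fst = x :=
          le_antisymm (hx.1 ⟨q, hq, rfl⟩) (h0 ▸ unitInterval.nonneg')
        have : q.snd = false := by simpa using h q hq hq0
        exact (fst_pos_of_snd this).ne (h0.trans hq0.symm)

/-- The two arrows space is compact, so that the topology of `C(TwoArrows, 𝕜)` is that of the
supremum norm. -/
instance : CompactSpace TwoArrows := by
  classical
  let _ : SupSet TwoArrows := ⟨fun s => (exists_isLUB s).choose⟩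
  let _ : CompleteLattice TwoArrows :=
    completeLatticeOfSup TwoArrows fun s => (exists_isLUB s).choose_spec
  let _ : ConditionallyCompleteLinearOrder TwoArrows :=
    { (inferInstance : ConditionallyCompleteLattice TwoArrows),
      (inferInstance : LinearOrder TwoArrows) with
      csSup_of_not_bddAbove := fun s h => (h (OrderTop.bddAbove s)).elim
      csInf_of_not_bddBelow := fun s h => (h (OrderBot.bddBelow s)).elim }
  have : OrderTopology TwoArrows := ⟨rfl⟩
  refine ⟨?_⟩
  rw [← Set.Icc_bot_top]
  exact isCompact_Icc

/-- The projection `(x, i) ↦ x` of the two arrows space onto `[0,1]`. -/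
def proj : C(TwoArrows, unitInterval) := ⟨fst, continuous_fst⟩

/-- The canonical copy of `C[0,1]` in `C(TwoArrows)`: the functions `(x, i) ↦ g x` with `g` a
continuous function on `[0,1]`. -/
noncomputable def continuousOnInterval (𝕜 : Type*) [RCLike 𝕜] : Submodule 𝕜 C(TwoArrows, 𝕜) :=
  LinearMap.range (ContinuousMap.compRightAlgHom 𝕜 𝕜 proj).toLinearMap

/-- Composition with the projection is isometric, so it identifies `C[0,1]` with
`continuousOnInterval`. -/
theorem norm_comp_proj {𝕜 : Type*} [RCLike 𝕜] (g : C(unitInterval, 𝕜)) :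
    ‖g.comp proj‖ = ‖g‖ := by
  apply le_antisymm
  · exact (ContinuousMap.norm_le _ (norm_nonneg _)).2 fun p => g.norm_coe_le_norm _
  · refine (ContinuousMap.norm_le _ (norm_nonneg _)).2 fun x => ?_
    obtain ⟨p, rfl⟩ := fst_surjective x
    exact (g.comp proj).norm_coe_le_norm p

end TwoArrows

open Set TopologicalSpace

namespace TwoArrows

/-! Modulo $C[0,1]$, the step functions behave like the unit vectors of $c_0$: subtracting steep
ramps leaves disjointly supported functions (`exists_norm_sum_smul_step_sub_le`). Let $P$ project
onto $Y \supseteq C[0,1]$; then $Q = 1 - P$ kills $C[0,1]$. For each point $p$, the values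
$Q(\mathrm{step}_x)(p)$ are therefore absolutely summable over $x$, hence nonzero for only countably
many $x$. As $K$ is separable, $\mathrm{step}_x \in Y$ for all but countably many $x$. The steps are
1-separated and uncountably many, so $Y$ is not separable; $Y = C[0,1]$ gives the first claim. -/

theorem eq_of_fst_snd {p q : TwoArrows} (h1 : p.fst = q.fst) (h2 : p.snd = q.snd) : p = q :=
  le_antisymm (le_iff.2 (Or.inr ⟨h1, h2.le⟩)) (le_iff.2 (Or.inr ⟨h1.symm, h2.ge⟩))

theorem fst_lt_of_lt_of_snd_true {p u : TwoArrows} (hp : p.snd = true) (h : p < u) :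
    p.fst < u.fst := by
  rcases lt_iff.1 h with h | ⟨-, h⟩
  · exact h
  · rw [hp] at h
    exact absurd h (not_lt.2 (Bool.le_true _))

theorem fst_lt_of_lt_of_snd_false {p u : TwoArrows} (hp : p.snd = false) (h : u < p) :
    u.fst < p.fst := by
  rcases lt_iff.1 h with h | ⟨-, h⟩
  · exact h
  · rw [hp] at h
    exact absurd h (not_lt.2 (Bool.false_le _))

/-- The two arrows space is separable: points over a dense set of `[0,1]` are dense. -/
theorem dense_preimage_fst {s : Set unitInterval} (hs : Dense s) : Dense (fst ⁻¹' s) := by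
  refine dense_iff_inter_open.2 fun U hU ⟨p, hp⟩ => ?_
  cases h : p.snd
  -- Neighbourhoods of $(x,0)$ extend to the left and those of $(x,1)$ to the right, so each
  -- contains whole fibres over an open interval.
  · have hlt : upper 0 zero_lt_one < p := lt_iff.2 (Or.inl (fst_pos_of_snd h))
    obtain ⟨u, hu, hsub⟩ := exists_Ioc_subset_of_mem_nhds (hU.mem_nhds hp) ⟨_, hlt⟩
    obtain ⟨x, hx, hux, hxp⟩ := hs.exists_between (fst_lt_of_lt_of_snd_false h hu)
    obtain ⟨q, rfl⟩ := fst_surjective x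
    exact ⟨q, hsub ⟨lt_iff.2 (Or.inl hux), (lt_iff.2 (Or.inl hxp)).le⟩, hx⟩
  · have hlt : p < lower 1 zero_lt_one := lt_iff.2 (Or.inl (fst_lt_one_of_snd h))
    obtain ⟨u, hu, hsub⟩ := exists_Ico_subset_of_mem_nhds (hU.mem_nhds hp) ⟨_, hlt⟩
    obtain ⟨x, hx, hpx, hxu⟩ := hs.exists_between (fst_lt_of_lt_of_snd_true h hu)
    obtain ⟨q, rfl⟩ := fst_surjective x
    exact ⟨q, hsub ⟨(lt_iff.2 (Or.inl hpx)).le, lt_iff.2 (Or.inl hxu)⟩, hx⟩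

theorem countable_preimage_fst {s : Set unitInterval} (hs : s.Countable) :
    (fst ⁻¹' s).Countable := by
  have hinj : Function.Injective fun p : TwoArrows => (p.fst, p.snd) := fun p q h =>
    eq_of_fst_snd (congrArg Prod.fst h) (congrArg Prod.snd h)
  refine ((hs.prod (countable_univ (α := Bool))).preimage hinj).mono fun p hp => ?_
  exact ⟨hp, mem_univ _⟩

instance : SeparableSpace TwoArrows := by
  obtain ⟨s, hs, hd⟩ := exists_countable_dense unitInterval
  exact ⟨_, countable_preimage_fst hs, dense_preimage_fst hd⟩

/-- No point lies between $(x,0)$ and $(x,1)$. This jump is what makes the step at $x$ continuous.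
-/
theorem Ici_upper_eq (x : unitInterval) (h0 : 0 < x) (h1 : x < 1) :
    Ici (upper x h1) = Ioi (lower x h0) := by
  ext p
  simp only [mem_Ici, mem_Ioi, le_iff, lt_iff]
  change x < p.fst ∨ x = p.fst ∧ true ≤ p.snd ↔ x < p.fst ∨ x = p.fst ∧ false < p.snd
  cases p.snd <;> simp

theorem isClopen_Ici_upper (x : unitInterval) (h0 : 0 < x) (h1 : x < 1) :
    IsClopen (Ici (upper x h1)) :=
  ⟨isClosed_Ici, Ici_upper_eq x h0 h1 ▸ isOpen_Ioi⟩

variable (𝕜 : Type*) [RCLike 𝕜]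

/-! ### Step functions and their distance to $C[0,1]$ -/

open Classical in
/-- The indicator function of the points from `(x, 1)` on. -/
noncomputable def step (x : Ioo (0 : unitInterval) 1) : C(TwoArrows, 𝕜) where
  toFun p := if upper x.1 x.2.2 ≤ p then 1 else 0
  continuous_toFun := by
    refine continuous_if (fun p hp => ?_) continuous_const.continuousOn continuous_const.continuousOn
    have h := (isClopen_Ici_upper x.1 x.2.1 x.2.2).frontier_eq
    exact absurd (h ▸ hp : p ∈ (∅ : Set TwoArrows)) (notMem_empty p)

variable {𝕜} in
theorem step_apply_of_le {x : Ioo (0 : unitInterval) 1} {p : TwoArrows}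
    (h : upper x.1 x.2.2 ≤ p) : step 𝕜 x p = 1 := if_pos h

variable {𝕜} in
theorem step_apply_of_lt {x : Ioo (0 : unitInterval) 1} {p : TwoArrows}
    (h : p < upper x.1 x.2.2) : step 𝕜 x p = 0 := if_neg h.not_ge

/-- The continuous function on `[0,1]` that grows linearly from `0` at `x` to `1` at `x + δ`. -/
noncomputable def ramp (x : unitInterval) (δ : ℝ) : C(unitInterval, 𝕜) where
  toFun t := ((min 1 (max 0 (((t : ℝ) - x) / δ)) : ℝ) : 𝕜)
  continuous_toFun := by fun_prop

theorem one_le_norm_step_sub_step {x y : Ioo (0 : unitInterval) 1} (h : x ≠ y) :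
    1 ≤ ‖step 𝕜 x - step 𝕜 y‖ := by
  wlog hxy : x < y generalizing x y
  · rw [norm_sub_rev]
    exact this h.symm (lt_of_le_of_ne (not_lt.1 hxy) h.symm)
  have hlt : upper x.1 x.2.2 < upper y.1 y.2.2 := lt_iff.2 (Or.inl hxy)
  have h := (step 𝕜 x - step 𝕜 y).norm_coe_le_norm (upper x.1 x.2.2)
  rwa [ContinuousMap.sub_apply, step_apply_of_le le_rfl, step_apply_of_lt hlt, sub_zero, norm_one] at h

theorem norm_step_sub_ramp_le (x : Ioo (0 : unitInterval) 1) {δ : ℝ} (p : TwoArrows) :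
    ‖(step 𝕜 x - (ramp 𝕜 x.1 δ).comp proj) p‖ ≤ 1 := by
  rw [ContinuousMap.sub_apply]
  set r : ℝ := min 1 (max 0 (((p.fst : ℝ) - x.1) / δ)) with hr
  have hrp : ((ramp 𝕜 x.1 δ).comp proj) p = (r : 𝕜) := rfl
  have hr0 : 0 ≤ r := le_min zero_le_one (le_max_left _ _)
  have hr1 : r ≤ 1 := min_le_left _ _
  rw [hrp]
  rcases le_or_gt (upper x.1 x.2.2) p with h | h
  · rw [step_apply_of_le h, ← RCLike.ofReal_one, ← RCLike.ofReal_sub, RCLike.norm_ofReal,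
      abs_le]
    constructor <;> linarith
  · rw [step_apply_of_lt h, zero_sub, norm_neg, RCLike.norm_ofReal, abs_of_nonneg hr0]
    exact hr1

variable {𝕜} in
-- Step and ramp are both 0 to the left of $x$ and both 1 from $x+\delta$ on. The half-open interval
-- keeps supports disjoint even when two points are exactly $\delta$ apart.
theorem mem_Ico_of_step_sub_ramp_ne_zero {x : Ioo (0 : unitInterval) 1} {δ : ℝ} (hδ : 0 < δ)
    {p : TwoArrows} (h : (step 𝕜 x - (ramp 𝕜 x.1 δ).comp proj) p ≠ 0) :
    (p.fst : ℝ) ∈ Ico (x.1 : ℝ) (x.1 + δ) := by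
  have hrp : ((ramp 𝕜 x.1 δ).comp proj) p =
    ((min 1 (max 0 (((p.fst : ℝ) - x.1) / δ)) : ℝ) : 𝕜) := rfl
  rw [ContinuousMap.sub_apply, hrp] at h
  by_contra hc
  apply h
  rcases lt_or_ge (p.fst : ℝ) x.1 with hlt | hge
  · rw [step_apply_of_lt (lt_iff.2 (Or.inl hlt)), max_eq_left, min_eq_right zero_le_one]
    · simp
    · exact div_nonpos_of_nonpos_of_nonneg (by linarith) hδ.le
  · have h2 : (x.1 : ℝ) + δ ≤ p.fst := not_lt.1 fun h2 => hc ⟨hge, h2⟩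
    have h3 : x.1 < p.fst := Subtype.coe_lt_coe.1 (by linarith)
    have h5 : upper x.1 x.2.2 < p := lt_iff.2 (Or.inl h3)
    have h4 : 1 ≤ ((p.fst : ℝ) - x.1) / δ := (one_le_div hδ).2 (by linarith)
    rw [step_apply_of_le h5.le, min_eq_left (h4.trans (le_max_right _ _))]
    simp

theorem exists_pos_forall_lt_add_le (s : Finset (Ioo (0 : unitInterval) 1)) :
    ∃ δ : ℝ, 0 < δ ∧ ∀ x ∈ s, ∀ y ∈ s, x < y → (x.1 : ℝ) + δ ≤ y.1 := by
  have h : ∀ᶠ δ : ℝ in nhdsWithin 0 (Ioi 0),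
      ∀ x ∈ s, ∀ y ∈ s, x < y → (x.1 : ℝ) + δ ≤ y.1 := by
    refine (s.eventually_all).2 fun x _ => (s.eventually_all).2 fun y _ => ?_
    by_cases hxy : x < y
    · have hpos : (0 : ℝ) < y.1 - x.1 := sub_pos.2 hxy
      filter_upwards [Ioo_mem_nhdsGT hpos] with δ hδ _
      linarith [hδ.2]
    · exact Filter.Eventually.of_forall fun _ h => absurd h hxy
  obtain ⟨δ, h1, h2⟩ := (h.and self_mem_nhdsWithin).exists
  exact ⟨δ, h2, h1⟩

variable {𝕜} in
/-- A combination of step functions is at distance at most `max ‖c x‖` from `C[0,1]`. -/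
theorem exists_norm_sum_smul_step_sub_le (s : Finset (Ioo (0 : unitInterval) 1))
    (c : Ioo (0 : unitInterval) 1 → 𝕜) (hc : ∀ x, ‖c x‖ ≤ 1) :
    ∃ g ∈ continuousOnInterval 𝕜, ‖∑ x ∈ s, c x • step 𝕜 x - g‖ ≤ 1 := by
  obtain ⟨δ, hδ, hsep⟩ := exists_pos_forall_lt_add_le s
  refine ⟨∑ x ∈ s, c x • (ramp 𝕜 x.1 δ).comp proj,
    Submodule.sum_mem _ fun x _ => Submodule.smul_mem _ _ ⟨ramp 𝕜 x.1 δ, rfl⟩, ?_⟩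
  rw [← Finset.sum_sub_distrib]
  simp_rw [← smul_sub]
  refine (ContinuousMap.norm_le _ zero_le_one).2 fun p => ?_
  rw [ContinuousMap.sum_apply]
  -- At most one summand is nonzero at `p`, so the coefficients contribute their maximum, not their
  -- sum.
  by_cases hp : ∃ x ∈ s, (step 𝕜 x - (ramp 𝕜 x.1 δ).comp proj) p ≠ 0
  · obtain ⟨x, hx, hxp⟩ := hp
    have hxI := mem_Ico_of_step_sub_ramp_ne_zero hδ hxp
    rw [Finset.sum_eq_single_of_mem x hx, ContinuousMap.smul_apply, norm_smul]
    · exact mul_le_one₀ (hc x) (norm_nonneg _) (norm_step_sub_ramp_le 𝕜 x p)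
    · intro y hy hyx
      rw [ContinuousMap.smul_apply]
      by_contra hne
      have hyI := mem_Ico_of_step_sub_ramp_ne_zero hδ (right_ne_zero_of_smul hne)
      rcases lt_or_gt_of_ne hyx with h | h
      · linarith [hsep y hy x hx h, hxI.1, hyI.2]
      · linarith [hsep x hx y hy h, hyI.1, hxI.2]
  · push Not at hp
    rw [Finset.sum_eq_zero fun x hx => by rw [ContinuousMap.smul_apply, hp x hx, smul_zero],
      norm_zero]
    exact zero_le_one

/-! ### Operators vanishing on $C[0,1]$, and separability -/

variable {𝕜} in
theorem sum_norm_apply_step_le (Q : C(TwoArrows, 𝕜) →L[𝕜] C(TwoArrows, 𝕜))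
    (hQ : ∀ g ∈ continuousOnInterval 𝕜, Q g = 0) (p : TwoArrows)
    (s : Finset (Ioo (0 : unitInterval) 1)) :
    ∑ x ∈ s, ‖Q (step 𝕜 x) p‖ ≤ ‖Q‖ := by
  -- Unimodular factors align the phases, turning the sum of norms into one value of `Q`. The bound
  -- does not depend on `s`, which yields summability.
  choose c hc1 hc using fun x => RCLike.exists_norm_eq_mul_self (Q (step 𝕜 x) p)
  obtain ⟨g, hg, hle⟩ := exists_norm_sum_smul_step_sub_le s c fun x => (hc1 x).le
  have hsum : ((∑ x ∈ s, ‖Q (step 𝕜 x) p‖ : ℝ) : 𝕜) =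
      Q (∑ x ∈ s, c x • step 𝕜 x - g) p := by
    rw [map_sub, hQ g hg, sub_zero, map_sum, ContinuousMap.sum_apply, RCLike.ofReal_sum]
    refine Finset.sum_congr rfl fun x _ => ?_
    rw [map_smul, ContinuousMap.smul_apply, hc x, smul_eq_mul]
  calc ∑ x ∈ s, ‖Q (step 𝕜 x) p‖
      = ‖((∑ x ∈ s, ‖Q (step 𝕜 x) p‖ : ℝ) : 𝕜)‖ := by
        rw [RCLike.norm_ofReal, abs_of_nonneg (Finset.sum_nonneg fun _ _ => norm_nonneg _)]
    _ = ‖Q (∑ x ∈ s, c x • step 𝕜 x - g) p‖ := by rw [hsum]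
    _ ≤ ‖Q (∑ x ∈ s, c x • step 𝕜 x - g)‖ := ContinuousMap.norm_coe_le_norm _ p
    _ ≤ ‖Q‖ * ‖∑ x ∈ s, c x • step 𝕜 x - g‖ := Q.le_opNorm _
    _ ≤ ‖Q‖ := mul_le_of_le_one_right (norm_nonneg _) hle

variable {𝕜} in
/-- An operator on `C(K)` that vanishes on `C[0,1]` vanishes on all but countably many of the
step functions. -/
theorem countable_setOf_apply_step_ne_zero (Q : C(TwoArrows, 𝕜) →L[𝕜] C(TwoArrows, 𝕜))
    (hQ : ∀ g ∈ continuousOnInterval 𝕜, Q g = 0) :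
    {x | Q (step 𝕜 x) ≠ 0}.Countable := by
  obtain ⟨T, hT, hd⟩ := exists_countable_dense TwoArrows
  have hcount : ∀ p ∈ T, {x | Q (step 𝕜 x) p ≠ 0}.Countable := fun p _ => by
    have hsum : Summable fun x => ‖Q (step 𝕜 x) p‖ :=
      summable_of_sum_le (fun _ => norm_nonneg _) (sum_norm_apply_step_le Q hQ p)
    exact hsum.countable_support.mono fun x hx => norm_ne_zero_iff.2 hx
  refine (hT.biUnion hcount).mono fun x hx => ?_
  by_contra hc
  refine hx (ContinuousMap.coe_injective ?_)
  refine Continuous.ext_on hd (Q (step 𝕜 x)).continuous continuous_zero fun p hp => ?_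
  by_contra hne
  exact hc (mem_biUnion hp hne)

variable {𝕜} in
/-- A separable set contains only countably many of the step functions. -/
theorem countable_setOf_step_mem {Y : Set C(TwoArrows, 𝕜)} (hY : IsSeparable Y) :
    {x | step 𝕜 x ∈ Y}.Countable := by
  obtain ⟨d, hd, hYd⟩ := hY
  -- Distinct steps are at distance at least 1, so no point of `d` is within 1/2 of two of them.
  have hex : ∀ x : {x // step 𝕜 x ∈ Y}, ∃ f ∈ d, dist (step 𝕜 x.1) f < 1 / 2 := fun x =>
    Metric.mem_closure_iff.1 (hYd x.2) _ one_half_pos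
  choose f hf hdist using hex
  have : Countable d := hd.to_subtype
  refine (Function.Injective.countable (f := fun x => (⟨f x, hf x⟩ : d)) fun x y hxy => ?_)
  by_contra hne
  have h1 := one_le_norm_step_sub_step 𝕜 fun h => hne (Subtype.ext h)
  rw [← dist_eq_norm] at h1
  have h2 := hdist y
  rw [← show f x = f y from congrArg Subtype.val hxy] at h2
  linarith [hdist x, dist_triangle_right (step 𝕜 x.1) (step 𝕜 y.1) (f x)]

theorem uncountable_Ioo : Uncountable (Ioo (0 : unitInterval) 1) := by
  rw [← not_countable_iff]
  intro h
  have h1 : Countable (Ioo (0 : ℝ) 1) :=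
    Function.Injective.countable
      (f := fun x : Ioo (0 : ℝ) 1 =>
        (⟨⟨x.1, x.2.1.le, x.2.2.le⟩, x.2.1, x.2.2⟩ : Ioo (0 : unitInterval) 1))
      fun x y hxy => Subtype.ext
        (congrArg (fun z : Ioo (0 : unitInterval) 1 => (z.1 : ℝ)) hxy)
  exact (Cardinal.Real.Ioo_countable_iff.1 h1).not_gt zero_lt_one

theorem isSeparable_continuousOnInterval :
    IsSeparable (continuousOnInterval 𝕜 : Set C(TwoArrows, 𝕜)) := by
  have h : (continuousOnInterval 𝕜 : Set C(TwoArrows, 𝕜)) =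
      range fun g : C(unitInterval, 𝕜) => g.comp proj := rfl
  rw [h]
  exact isSeparable_range (ContinuousMap.continuous_precomp proj)

variable {𝕜} in
theorem not_isSeparable_of_closedComplemented {Y : Submodule 𝕜 C(TwoArrows, 𝕜)}
    (hY : Y.ClosedComplemented) (hle : continuousOnInterval 𝕜 ≤ Y) :
    ¬ IsSeparable (Y : Set C(TwoArrows, 𝕜)) := by
  intro hsep
  obtain ⟨P, hP⟩ := hY
  let Q : C(TwoArrows, 𝕜) →L[𝕜] C(TwoArrows, 𝕜) :=
    ContinuousLinearMap.id 𝕜 _ - Y.subtypeL.comp P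
  have hQ : ∀ f, Q f = f - P f := fun _ => rfl
  have h1 := countable_setOf_apply_step_ne_zero Q fun g hg => by
    rw [hQ, hP ⟨g, hle hg⟩, sub_self]
  have h2 := countable_setOf_step_mem hsep
  have := uncountable_Ioo
  -- If $Q(\mathrm{step}_x) = 0$, then $\mathrm{step}_x$ equals its projection and lies in `Y`; so
  -- two countable sets would cover the uncountable index set.
  refine not_countable_univ ((h1.union h2).mono fun x _ => ?_)
  by_cases hx : Q (step 𝕜 x) = 0
  · refine Or.inr ?_
    rw [hQ, sub_eq_zero] at hx
    change step 𝕜 x ∈ Y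
    rw [hx]
    exact (P _).2
  · exact Or.inl hx

end TwoArrows

theorem mainTheorem8 (𝕜 : Type*) [RCLike 𝕜] :
    ¬ (TwoArrows.continuousOnInterval 𝕜).ClosedComplemented ∧
      ¬ ∃ Y : Submodule 𝕜 C(TwoArrows, 𝕜),
        Y.ClosedComplemented ∧ TopologicalSpace.IsSeparable (Y : Set C(TwoArrows, 𝕜)) ∧
          TwoArrows.continuousOnInterval 𝕜 ≤ Y :=
  ⟨fun h => TwoArrows.not_isSeparable_of_closedComplemented h le_rfl
      (TwoArrows.isSeparable_continuousOnInterval 𝕜),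
    fun ⟨_, hY, hsep, hle⟩ => TwoArrows.not_isSeparable_of_closedComplemented hY hle hsep⟩
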